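/- Let $(\mathcal C,\mathbb E,\mathfrak s)$ be an extriangulated category in the sense of Nakaoka and Palu: $\mathcal C$ is an additive category, $\mathbb E:\mathcal C^{op}\times\mathcal C\to\mathbf{Ab}$ is an additive bifunctor, and $\mathfrak s$ is an additive realization assigning to each $\eta\in\mathbb E(K,A)$ an equivalence class of sequences $A\to E\to K$, such that (ET3), (ET3)$^{op}$, (ET4), (ET4)$^{op}$ hold. Write $g\cdot\eta:=\mathbb E(K,g)(\eta)$ and $\eta\cdot f:=\mathbb E(f,A)(\eta)$. For a set $I$ and an object $A$, $A^{(I)}$ and $A^{I}$ denote the coproduct and the product of $I$ copies of $A$; $\mu_i$ denotes the canonical inclusions into a coproduct and $\pi_i$ the canonical projections from a product. A negative first extension on $\mathcal C$ consists of an additive bifunctor $\mathbb E^{-1}:\mathcal C^{op}\times\mathcal C\to\mathbf{Ab}$ together with, for every $\delta\in\mathbb E(K,A)$, homomorphisms $\mathbb E^{-1}(W,K)\to\mathrm{Hom}(W,A)$ and $\mathbb E^{-1}(A,W)\to\mathrm{Hom}(K,W)$, natural in $W$ and with respect to morphisms of $\mathbb E$-extensions, such that whenever $\delta$ is realized by $A\to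 E\to K$ the sequences $$\mathbb E^{-1}(W,A)\to\mathbb E^{-1}(W,E)\to\mathbb E^{-1}(W,K)\to\mathrm{Hom}(W,A)\to\mathrm{Hom}(W,E),$$ $$\mathbb E^{-1}(K,W)\to\mathbb E^{-1}(E,W)\to\mathbb E^{-1}(A,W)\to\mathrm{Hom}(K,W)\to\mathrm{Hom}(E,W)$$ are exact for every object $W$. **Theorem A.** Assume that $\mathcal C$ has coproducts. Consider the following statements. (a) $\mathcal C$ is AET4: for every set $I\neq\emptyset$ there is a transformation $\Gamma:\prod_{i\in I}\mathbb E(B_i,A)\to\mathbb E(\coprod_{i\in I}B_i,A^{(I)})$, natural in the family $(B_i)_{i\in I}$ and in $A$, such that (1) if each $\eta_i\in\mathbb E(B_i,A)$ is realized by $A\xrightarrow{f_i}E_i\xrightarrow{g_i}B_i$, then $\Gamma((\eta_i)_i)$ is realized by $A^{(I)}\xrightarrow{\coprod f_i}\coprod_i E_i\xrightarrow{\coprod g_i}\coprod_i B_i$, and (2) $\Gamma((\eta_i)_i)\cdot\mu_i^{B}=\mu_i^{A}\cdot\eta_i$ for all $i\in I$. (b) For every set $I\neq\emptyset$, the map $\tau:\mathbb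 E(\coprod_{i\in I}A_i,B)\to\prod_{i\in I}\mathbb E(A_i,B)$, $\epsilon\mapsto(\epsilon\cdot\mu_i)_{i\in I}$, is a natural isomorphism. (c) For all objects $V,D$ there is a universal $\mathbb E$-extension of $V$ by $D$: a set $X\neq\emptyset$ and $\eta\in\mathbb E(V^{(X)},D)$ such that $\mathrm{Hom}(V,V^{(X)})\to\mathbb E(V,D)$, $f\mapsto\eta\cdot f$, is surjective. Then (a) implies (b), and (b) is equivalent to (c). If moreover $\mathcal C$ is coproduct-compatible, that is, it has a negative first extension for which $\mathbb E^{-1}(\coprod_{i\in I}Y_i,X)\to\prod_{i\in I}\mathbb E^{-1}(Y_i,X)$, induced by the $\mu_i$, is an epimorphism for every object $X$, every set $I\ne\emptyset$ and every family $(Y_i)_{i\in I}$, then (a), (b) and (c) are equivalent. **Dual form.** Assume that $\mathcal C$ has products. Consider the following statements. (a*) $\mathcal C$ is AET4*: the opposite extriangulated category $\mathcal C^{op}$ is AET4. (b*) For every set $I\neq\emptyset$, the map $\mathbb E(A,\prod_{i\in I}B_i)\to\prod_{i\in I}\mathbb E(A,B_i)$, $\epsilon\mapsto(\pi_i\cdot\epsilon)_{i\in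 I}$, is a natural isomorphism. (c*) For all objects $V,D$ there is a universal $\mathbb E$-coextension of $V$ by $D$: a set $X\neq\emptyset$ and $\eta\in\mathbb E(D,V^{X})$ such that $\mathrm{Hom}(V^{X},V)\to\mathbb E(D,V)$, $g\mapsto g\cdot\eta$, is surjective. Then (a*) implies (b*), and (b*) is equivalent to (c*). If moreover $\mathcal C$ is product-compatible, that is, it has a negative first extension for which $\mathbb E^{-1}(X,\prod_{i\in I}Y_i)\to\prod_{i\in I}\mathbb E^{-1}(X,Y_i)$, induced by the $\pi_i$, is an epimorphism for every object $X$, every set $I\ne\emptyset$ and every family $(Y_i)_{i\in I}$, then (a*), (b*) and (c*) are equivalent. -/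

import Mathlib

open CategoryTheory CategoryTheory.Limits Opposite

universe w v u

namespace Extri

/-! ## Bifunctors with values in abelian groups -/

section Bifunctor

variable {C : Type u} [Category.{v} C]

/-- The group `E(K, A)` of `E`-extensions of `K` by `A`. -/
abbrev ExtGrp (E : Cᵒᵖ ⥤ C ⥤ AddCommGrpCat.{w}) (K A : C) : Type w :=
  (E.obj (op K)).obj A

/-- The action `a · δ = E(K, a)(δ)`. -/
def push (E : Cᵒᵖ ⥤ C ⥤ AddCommGrpCat.{w}) {K A A' : C} (a : A ⟶ A') :
    ExtGrp E K A →+ ExtGrp E K A' :=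
  ((E.obj (op K)).map a).hom

/-- The action `δ · c = E(c, A)(δ)`. -/
def pull (E : Cᵒᵖ ⥤ C ⥤ AddCommGrpCat.{w}) {K K' A : C} (c : K' ⟶ K) :
    ExtGrp E K A →+ ExtGrp E K' A :=
  ((E.map c.op).app A).hom

/-- `E` is additive in each of its two variables. -/
structure IsAdditiveBifunctor [Preadditive C] (E : Cᵒᵖ ⥤ C ⥤ AddCommGrpCat.{w}) : Prop where
  push_add : ∀ {K A A' : C} (a b : A ⟶ A') (δ : ExtGrp E K A),
    push E (a + b) δ = push E a δ + push E b δ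
  pull_add : ∀ {K K' A : C} (c d : K' ⟶ K) (δ : ExtGrp E K A),
    pull E (c + d) δ = pull E c δ + pull E d δ

variable (E : Cᵒᵖ ⥤ C ⥤ AddCommGrpCat.{w})

theorem push_id {K A : C} (δ : ExtGrp E K A) : push E (𝟙 A) δ = δ := by
  simp [push]

theorem pull_id {K A : C} (δ : ExtGrp E K A) : pull E (𝟙 K) δ = δ := by
  simp [pull]

theorem push_comp {K A A' A'' : C} (a : A ⟶ A') (b : A' ⟶ A'') (δ : ExtGrp E K A) :
    push E (a ≫ b) δ = push E b (push E a δ) := by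
  simp [push]

theorem pull_comp {K K' K'' A : C} (c : K' ⟶ K) (d : K'' ⟶ K') (δ : ExtGrp E K A) :
    pull E (d ≫ c) δ = pull E d (pull E c δ) := by
  simp [pull]

theorem pull_push {K K' A A' : C} (c : K' ⟶ K) (a : A ⟶ A') (δ : ExtGrp E K A) :
    pull E c (push E a δ) = push E a (pull E c δ) :=
  ConcreteCategory.congr_hom ((E.map c.op).naturality a) δ

/-- The direct sum `δ ⊕ δ'` in `E(K ⊞ K', A ⊞ A')`. -/
noncomputable def extSum [Preadditive C] [HasBinaryBiproducts C] {K A K' A' : C}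
    (δ : ExtGrp E K A) (δ' : ExtGrp E K' A') : ExtGrp E (K ⊞ K') (A ⊞ A') :=
  push E biprod.inl (pull E biprod.fst δ) + push E biprod.inr (pull E biprod.snd δ')

theorem push_pull_extSum [Preadditive C] [HasBinaryBiproducts C] {K A K' A' L M : C}
    (δ : ExtGrp E K A) (δ' : ExtGrp E K' A') (a : A ⊞ A' ⟶ L) (c : M ⟶ K ⊞ K') :
    push E a (pull E c (extSum E δ δ')) =
      pull E (c ≫ biprod.fst) (push E (biprod.inl ≫ a) δ) +
        pull E (c ≫ biprod.snd) (push E (biprod.inr ≫ a) δ') := by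
  simp only [extSum, map_add, pull_comp, push_comp, pull_push]

/-- The opposite bifunctor on `Cᵒᵖ`: its value at `(K, A)` is `E(A, K)`. -/
def opBifunctor : (Cᵒᵖ)ᵒᵖ ⥤ Cᵒᵖ ⥤ AddCommGrpCat.{w} :=
  unopUnop C ⋙ E.flip

end Bifunctor

/-! ## Sequences `A ⟶ mid ⟶ K` up to equivalence -/

section Sequences

variable {C : Type u} [Category.{v} C]

/-- A sequence of morphisms `A ⟶ mid ⟶ K` with prescribed ends. -/
structure Seq (A K : C) where
  mid : C
  f : A ⟶ mid
  g : mid ⟶ K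

/-- Two sequences with the same ends are equivalent if there is an isomorphism of their middle
terms that is compatible with the identities of the ends. -/
instance Seq.setoid (A K : C) : Setoid (Seq A K) where
  r S S' := ∃ e : S.mid ≅ S'.mid, S.f ≫ e.hom = S'.f ∧ e.hom ≫ S'.g = S.g
  iseqv :=
    { refl := fun S => ⟨Iso.refl _, by simp, by simp⟩
      symm := by
        rintro S S' ⟨e, h1, h2⟩
        exact ⟨e.symm, by simp [← h1], by simp [← h2]⟩
      trans := by
        rintro S S' S'' ⟨e, h1, h2⟩ ⟨e', h1', h2'⟩
        exact ⟨e ≪≫ e', by simp [← h1', ← h1], by simp [h2', h2]⟩ }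

/-- Equivalence classes `[A ⟶ mid ⟶ K]`. -/
abbrev SeqClass (A K : C) : Type (max u v) := Quotient (Seq.setoid A K)

/-- The same sequence read in the opposite category. -/
def Seq.op {A K : C} (S : Seq A K) : Seq (Opposite.op K) (Opposite.op A) where
  mid := Opposite.op S.mid
  f := S.g.op
  g := S.f.op

/-- Passage to the opposite category on equivalence classes of sequences. -/
def SeqClass.op {A K : C} : SeqClass A K → SeqClass (Opposite.op K) (Opposite.op A) :=
  Quotient.map Seq.op (by
    rintro S S' ⟨e, h1, h2⟩
    refine ⟨e.symm.op, ?_, ?_⟩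
    · simp only [Seq.op, Iso.op_hom, Iso.symm_hom, ← op_comp]
      rw [← h2]; simp
    · simp only [Seq.op, Iso.op_hom, Iso.symm_hom, ← op_comp]
      rw [← h1]; simp)

theorem seqClass_op_eq {K A : Cᵒᵖ} {q : SeqClass K.unop A.unop} {S : Seq A K}
    (h : q.op = (⟦S⟧ : SeqClass A K)) :
    q = ⟦⟨S.mid.unop, S.g.unop, S.f.unop⟩⟧ := by
  induction q using Quotient.inductionOn with
  | h T =>
    obtain ⟨e, h1, h2⟩ := Quotient.exact h
    refine Quotient.sound ⟨e.symm.unop, ?_, ?_⟩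
    · exact Quiver.Hom.op_inj ((Iso.inv_comp_eq e).mpr h2.symm)
    · exact Quiver.Hom.op_inj ((Iso.comp_inv_eq e).mpr h1.symm)

end Sequences

/-! ## Biproducts in the opposite category -/

section OpBiproducts

variable {C : Type u} [Category.{v} C] [Preadditive C] [HasBinaryBiproducts C]

/-- The isomorphism between the two biproducts of two objects of `Cᵒᵖ`. -/
noncomputable def opBiprodIso (A B : Cᵒᵖ) : Opposite.op (A.unop ⊞ B.unop) ≅ A ⊞ B where
  hom := biprod.lift (biprod.inl : A.unop ⟶ A.unop ⊞ B.unop).op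
    (biprod.inr : B.unop ⟶ A.unop ⊞ B.unop).op
  inv := biprod.desc (biprod.fst : A.unop ⊞ B.unop ⟶ A.unop).op
    (biprod.snd : A.unop ⊞ B.unop ⟶ B.unop).op
  hom_inv_id := by
    rw [biprod.lift_desc, ← op_comp, ← op_comp, ← op_add, biprod.total]; rfl
  inv_hom_id := by
    apply biprod.hom_ext' <;> apply biprod.hom_ext <;> simp [← op_comp]

theorem fst_op_opBiprodIso (A B : Cᵒᵖ) :
    (biprod.fst : A.unop ⊞ B.unop ⟶ A.unop).op ≫ (opBiprodIso A B).hom = biprod.inl := by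
  rw [← Iso.eq_comp_inv]; simp [opBiprodIso]

theorem snd_op_opBiprodIso (A B : Cᵒᵖ) :
    (biprod.snd : A.unop ⊞ B.unop ⟶ B.unop).op ≫ (opBiprodIso A B).hom = biprod.inr := by
  rw [← Iso.eq_comp_inv]; simp [opBiprodIso]

theorem opBiprodIso_inv_inl (A B : Cᵒᵖ) :
    (opBiprodIso A B).inv ≫ (biprod.inl : A.unop ⟶ A.unop ⊞ B.unop).op = biprod.fst := by
  rw [Iso.inv_comp_eq]; simp [opBiprodIso]

theorem opBiprodIso_inv_inr (A B : Cᵒᵖ) :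
    (opBiprodIso A B).inv ≫ (biprod.inr : B.unop ⟶ A.unop ⊞ B.unop).op = biprod.snd := by
  rw [Iso.inv_comp_eq]; simp [opBiprodIso]

theorem map_op_opBiprodIso {A B A' B' : Cᵒᵖ} (f : A ⟶ A') (g : B ⟶ B') :
    (biprod.map f.unop g.unop).op ≫ (opBiprodIso A' B').hom =
      (opBiprodIso A B).hom ≫ biprod.map f g := by
  apply biprod.hom_ext
  · simp only [opBiprodIso, Category.assoc, biprod.lift_fst, biprod.map_fst, ← op_comp,
      biprod.inl_map, biprod.lift_fst_assoc]
    rfl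
  · simp only [opBiprodIso, Category.assoc, biprod.lift_snd, biprod.map_snd, ← op_comp,
      biprod.inr_map, biprod.lift_snd_assoc]
    rfl

end OpBiproducts

/-! ## Extriangulated categories -/

/-- An extriangulated structure `(E, s)` on an additive category `C`, in the sense of
Nakaoka and Palu. -/
structure Extriangulated (C : Type u) [Category.{v} C] [Preadditive C] [HasZeroObject C]
    [HasBinaryBiproducts C] where
  /-- (ET1) the additive bifunctor of extensions -/
  E : Cᵒᵖ ⥤ C ⥤ AddCommGrpCat.{w}
  additive : IsAdditiveBifunctor E
  /-- (ET2) the realization, which is additive -/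
  s : ∀ {K A : C}, ExtGrp E K A → SeqClass A K
  realize_map : ∀ {K A K' A' : C} {δ : ExtGrp E K A} {δ' : ExtGrp E K' A'}
    {S : Seq A K} {S' : Seq A' K'}, s δ = ⟦S⟧ → s δ' = ⟦S'⟧ →
    ∀ (a : A ⟶ A') (c : K ⟶ K'), push E a δ = pull E c δ' →
      ∃ b : S.mid ⟶ S'.mid, S.f ≫ b = a ≫ S'.f ∧ S.g ≫ c = b ≫ S'.g
  realize_zero : ∀ K A : C,
    s (0 : ExtGrp E K A) = ⟦⟨A ⊞ K, biprod.inl, biprod.snd⟩⟧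
  realize_sum : ∀ {K A K' A' : C} {δ : ExtGrp E K A} {δ' : ExtGrp E K' A'}
    {S : Seq A K} {S' : Seq A' K'}, s δ = ⟦S⟧ → s δ' = ⟦S'⟧ →
      s (extSum E δ δ') =
        ⟦⟨S.mid ⊞ S'.mid, biprod.map S.f S'.f, biprod.map S.g S'.g⟩⟧
  /-- (ET3) -/
  et3 : ∀ {K A K' A' : C} {δ : ExtGrp E K A} {δ' : ExtGrp E K' A'}
    {S : Seq A K} {S' : Seq A' K'}, s δ = ⟦S⟧ → s δ' = ⟦S'⟧ →
    ∀ (a : A ⟶ A') (b : S.mid ⟶ S'.mid), S.f ≫ b = a ≫ S'.f →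
      ∃ c : K ⟶ K', S.g ≫ c = b ≫ S'.g ∧ push E a δ = pull E c δ'
  /-- (ET3)ᵒᵖ -/
  et3_op : ∀ {K A K' A' : C} {δ : ExtGrp E K A} {δ' : ExtGrp E K' A'}
    {S : Seq A K} {S' : Seq A' K'}, s δ = ⟦S⟧ → s δ' = ⟦S'⟧ →
    ∀ (b : S.mid ⟶ S'.mid) (c : K ⟶ K'), S.g ≫ c = b ≫ S'.g →
      ∃ a : A ⟶ A', S.f ≫ b = a ≫ S'.f ∧ push E a δ = pull E c δ'
  /-- (ET4) -/
  et4 : ∀ {A B M D F : C} {f : A ⟶ B} {f' : B ⟶ D} {g : B ⟶ M} {g' : M ⟶ F}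
    {δ : ExtGrp E D A} {δ' : ExtGrp E F B}, s δ = ⟦⟨B, f, f'⟩⟧ → s δ' = ⟦⟨M, g, g'⟩⟧ →
      ∃ (N : C) (h' : M ⟶ N) (d : D ⟶ N) (e : N ⟶ F) (δ'' : ExtGrp E N A),
        f' ≫ d = g ≫ h' ∧ h' ≫ e = g' ∧
        s δ'' = ⟦⟨M, f ≫ g, h'⟩⟧ ∧
        s (push E f' δ') = ⟦⟨N, d, e⟩⟧ ∧
        pull E d δ'' = δ ∧
        push E f δ'' = pull E e δ'
  /-- (ET4)ᵒᵖ -/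
  et4_op : ∀ {D M B F K : C} {f' : D ⟶ M} {f : M ⟶ B} {g' : F ⟶ B} {g : B ⟶ K}
    {δ : ExtGrp E B D} {δ' : ExtGrp E K F}, s δ = ⟦⟨M, f', f⟩⟧ → s δ' = ⟦⟨B, g', g⟩⟧ →
      ∃ (N : C) (d : D ⟶ N) (e : N ⟶ F) (h' : N ⟶ M) (δ'' : ExtGrp E K N),
        d ≫ h' = f' ∧ h' ≫ f = e ≫ g' ∧
        s δ'' = ⟦⟨M, h', f ≫ g⟩⟧ ∧
        s (pull E g' δ) = ⟦⟨N, d, e⟩⟧ ∧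
        push E e δ'' = δ' ∧
        push E d δ = pull E g δ''

namespace Extriangulated

variable {C : Type u} [Category.{v} C] [Preadditive C] [HasZeroObject C]
  [HasBinaryBiproducts C] (X : Extriangulated.{w} C)

/-! ### The opposite extriangulated category -/

section Opp

/-- In a conflation, a morphism that is killed by the deflation factors through the
inflation. -/
theorem lift_of_comp_eq_zero {K A W : C} {δ : ExtGrp X.E K A} {S : Seq A K}
    (hS : X.s δ = ⟦S⟧) (n : W ⟶ S.mid) (hn : n ≫ S.g = 0) : ∃ m : W ⟶ A, m ≫ S.f = n := by
  obtain ⟨Z, hZ⟩ := HasZeroObject.zero (C := C)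
  obtain ⟨a, ha, -⟩ := X.et3_op (X.realize_zero Z W) hS (biprod.fst ≫ n)
    (hZ.to_ K) (by
      have h0 : (biprod.snd : W ⊞ Z ⟶ Z) = 0 := hZ.eq_of_tgt _ _
      simp [h0, hn])
  exact ⟨a, by simpa using ha.symm⟩

/-- An endomorphism of a conflation that is the identity on both ends is an isomorphism. -/
theorem isIso_of_ends {K A : C} {δ : ExtGrp X.E K A} {S : Seq A K}
    (hS : X.s δ = ⟦S⟧) (b : S.mid ⟶ S.mid) (hf : S.f ≫ b = S.f) (hg : b ≫ S.g = S.g) :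
    IsIso b := by
  obtain ⟨m, hm⟩ := X.lift_of_comp_eq_zero hS (b - 𝟙 _) (by simp [hg])
  have hsq : (b - 𝟙 _) ≫ (b - 𝟙 _) = 0 := by
    conv_lhs => rw [← hm, Category.assoc, hm]
    simp [hf]
  have hbb : b ≫ b = b + b - 𝟙 _ := by
    simp only [Preadditive.comp_sub, Preadditive.sub_comp, Category.comp_id,
      Category.id_comp] at hsq
    have := sub_eq_zero.mp hsq
    rw [sub_eq_iff_eq_add] at this
    rw [this]; abel
  exact ⟨𝟙 _ + 𝟙 _ - b, by simp [hbb], by simp [hbb]⟩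

/-- Transport of a realization along isomorphisms of the ends. -/
theorem realize_iso {K A K' A' : C} {δ : ExtGrp X.E K A} {S : Seq A K}
    (hS : X.s δ = ⟦S⟧) (a : A ≅ A') (c : K' ≅ K) :
    X.s (push X.E a.hom (pull X.E c.hom δ)) = ⟦⟨S.mid, a.inv ≫ S.f, S.g ≫ c.inv⟩⟧ := by
  obtain ⟨S', hS'⟩ := Quotient.exists_rep (X.s (push X.E a.hom (pull X.E c.hom δ)))
  rw [← hS']
  obtain ⟨b, hb1, hb2⟩ := X.realize_map hS hS'.symm a.hom c.inv (by
    rw [pull_push, ← pull_comp, c.inv_hom_id, pull_id])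
  obtain ⟨b', hb1', hb2'⟩ := X.realize_map hS'.symm hS a.inv c.hom (by
    rw [← push_comp, a.hom_inv_id, push_id])
  have h1 : IsIso (b ≫ b') := X.isIso_of_ends hS _
    (by rw [← Category.assoc, hb1, Category.assoc, hb1', a.hom_inv_id_assoc])
    (by rw [Category.assoc, ← hb2', ← Category.assoc, ← hb2, Category.assoc, c.inv_hom_id,
      Category.comp_id])
  have h2 : IsIso (b' ≫ b) := X.isIso_of_ends hS'.symm _
    (by rw [← Category.assoc, hb1', Category.assoc, hb1, a.inv_hom_id_assoc])
    (by rw [Category.assoc, ← hb2, ← Category.assoc, ← hb2', Category.assoc, c.hom_inv_id,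
      Category.comp_id])
  have hb' : IsIso b' := by
    have : IsSplitEpi b' := ⟨⟨⟨inv (b ≫ b') ≫ b, by simp⟩⟩⟩
    have : Mono b' := by
      have : Mono (b' ≫ b) := inferInstance
      exact mono_of_mono b' b
    exact isIso_of_mono_of_isSplitEpi b'
  refine Quotient.sound ⟨asIso b', ?_, ?_⟩
  · simpa using hb1'
  · simp only [asIso_hom]
    rw [← Category.assoc, ← hb2', Category.assoc, c.hom_inv_id, Category.comp_id]

/-- The opposite of an extriangulated category. -/
noncomputable def op : Extriangulated.{w} Cᵒᵖ where
  E := opBifunctor X.E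
  additive :=
    { push_add := fun a b δ => X.additive.pull_add a.unop b.unop δ
      pull_add := fun c d δ => X.additive.push_add c.unop d.unop δ }
  s := fun {K A} δ => (X.s (K := A.unop) (A := K.unop) δ).op
  realize_map := by
    intro K A K' A' δ δ' S S' hS hS' a c h
    obtain ⟨b, h1, h2⟩ := X.realize_map (seqClass_op_eq hS') (seqClass_op_eq hS) c.unop a.unop
      h.symm
    exact ⟨b.op, Quiver.Hom.unop_inj h2.symm, Quiver.Hom.unop_inj h1.symm⟩
  realize_zero := by
    intro K A
    refine (congrArg SeqClass.op (X.realize_zero A.unop K.unop)).trans ?_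
    refine Quotient.sound ⟨opBiprodIso K A ≪≫ biprod.braiding K A, ?_, ?_⟩
    · change (biprod.snd : K.unop ⊞ A.unop ⟶ A.unop).op ≫ _ ≫ _ = _
      rw [← Category.assoc, snd_op_opBiprodIso]
      apply biprod.hom_ext <;> simp
    · change ((opBiprodIso K A).hom ≫ (biprod.braiding K A).hom) ≫
        (biprod.snd : A ⊞ K ⟶ K) = (biprod.inl : K.unop ⟶ K.unop ⊞ A.unop).op
      rw [Category.assoc, ← Iso.eq_inv_comp, opBiprodIso_inv_inl]; simp
  realize_sum := by
    intro K A K' A' δ δ' S S' hS hS'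
    have h := X.realize_iso (X.realize_sum (seqClass_op_eq hS) (seqClass_op_eq hS'))
      (opBiprodIso K K').unop.symm (opBiprodIso A A').unop
    have key : extSum (opBifunctor X.E) δ δ' =
        push X.E (opBiprodIso K K').unop.symm.hom (pull X.E (opBiprodIso A A').unop.hom
          (extSum X.E (K := A.unop) (A := K.unop) (K' := A'.unop) (A' := K'.unop) δ δ')) := by
      have e1 : (biprod.inl : K.unop ⟶ K.unop ⊞ K'.unop) ≫ (opBiprodIso K K').unop.symm.hom =
          (biprod.fst : K ⊞ K' ⟶ K).unop := Quiver.Hom.op_inj (opBiprodIso_inv_inl K K')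
      have e2 : (biprod.inr : K'.unop ⟶ K.unop ⊞ K'.unop) ≫ (opBiprodIso K K').unop.symm.hom =
          (biprod.snd : K ⊞ K' ⟶ K').unop := Quiver.Hom.op_inj (opBiprodIso_inv_inr K K')
      have e3 : (opBiprodIso A A').unop.hom ≫ (biprod.fst : A.unop ⊞ A'.unop ⟶ A.unop) =
          (biprod.inl : A ⟶ A ⊞ A').unop := Quiver.Hom.op_inj (fst_op_opBiprodIso A A')
      have e4 : (opBiprodIso A A').unop.hom ≫ (biprod.snd : A.unop ⊞ A'.unop ⟶ A'.unop) =
          (biprod.inr : A' ⟶ A ⊞ A').unop := Quiver.Hom.op_inj (snd_op_opBiprodIso A A')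
      have h1 : extSum (opBifunctor X.E) δ δ' =
          pull X.E (biprod.inl : A ⟶ A ⊞ A').unop (push X.E (biprod.fst : K ⊞ K' ⟶ K).unop
            (δ : ExtGrp X.E A.unop K.unop)) +
          pull X.E (biprod.inr : A' ⟶ A ⊞ A').unop (push X.E (biprod.snd : K ⊞ K' ⟶ K').unop
            (δ' : ExtGrp X.E A'.unop K'.unop)) := rfl
      have h2 := push_pull_extSum X.E (K := A.unop) (A := K.unop) (K' := A'.unop) (A' := K'.unop)
        δ δ' (opBiprodIso K K').unop.symm.hom (opBiprodIso A A').unop.hom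
      rw [e1, e2, e3, e4] at h2
      exact h1.trans h2.symm
    rw [key]
    refine (congrArg SeqClass.op h).trans (Quotient.sound ⟨opBiprodIso S.mid S'.mid, ?_, ?_⟩)
    · change ((opBiprodIso A A').inv ≫ (biprod.map S.f.unop S'.f.unop).op) ≫
        (opBiprodIso S.mid S'.mid).hom = biprod.map S.f S'.f
      rw [Category.assoc, Iso.inv_comp_eq, map_op_opBiprodIso]
    · change (opBiprodIso S.mid S'.mid).hom ≫ biprod.map S.g S'.g =
        (biprod.map S.g.unop S'.g.unop).op ≫ (opBiprodIso K K').hom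
      rw [map_op_opBiprodIso]
  et3 := by
    intro K A K' A' δ δ' S S' hS hS' a b h
    obtain ⟨c, h1, h2⟩ := X.et3_op (seqClass_op_eq hS') (seqClass_op_eq hS) b.unop a.unop
      (Quiver.Hom.op_inj h.symm)
    exact ⟨c.op, Quiver.Hom.unop_inj h1.symm, h2.symm⟩
  et3_op := by
    intro K A K' A' δ δ' S S' hS hS' b c h
    obtain ⟨a, h1, h2⟩ := X.et3 (seqClass_op_eq hS') (seqClass_op_eq hS) c.unop b.unop
      (Quiver.Hom.op_inj h.symm)
    exact ⟨a.op, Quiver.Hom.unop_inj h1.symm, h2.symm⟩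
  et4 := by
    intro A B M D F f f' g g' δ δ' h h'
    obtain ⟨N, d, e, k, δ'', h1, h2, h3, h4, h5, h6⟩ :=
      X.et4_op (seqClass_op_eq h') (seqClass_op_eq h)
    exact ⟨Opposite.op N, k.op, e.op, d.op, δ'', Quiver.Hom.unop_inj h2.symm,
      Quiver.Hom.unop_inj h1,
      congrArg SeqClass.op h3, congrArg SeqClass.op h4, h5, h6.symm⟩
  et4_op := by
    intro D M B F K f' f g' g δ δ' h h'
    obtain ⟨N, k, d, e, δ'', h1, h2, h3, h4, h5, h6⟩ :=
      X.et4 (seqClass_op_eq h') (seqClass_op_eq h)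
    exact ⟨Opposite.op N, e.op, d.op, k.op, δ'', Quiver.Hom.unop_inj h2,
      Quiver.Hom.unop_inj h1.symm,
      congrArg SeqClass.op h3, congrArg SeqClass.op h4, h5, h6.symm⟩

end Opp

/-! ### Coproducts and the condition AET4 -/

section Coproducts

/-- The functor `∐ : (I → C) ⥤ C` on the product category. -/
noncomputable def coprodFunctor (C : Type u) [Category.{v} C] (I : Type w)
    [HasCoproductsOfShape I C] : (I → C) ⥤ C where
  obj B := ∐ B
  map b := Limits.Sigma.map b

/-- The functor `A ↦ A^(I)`, the coproduct of `I` copies of `A`. -/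
noncomputable def copowerFunctor (C : Type u) [Category.{v} C] (I : Type w)
    [HasCoproductsOfShape I C] : C ⥤ C where
  obj A := ∐ fun _ : I => A
  map a := Limits.Sigma.map fun _ => a

/-- The bifunctor `(B, A) ↦ ∏ i, E(B i, A)` on `(I → C)ᵒᵖ × C`. -/
def prodExtLeft (I : Type w) : (I → C)ᵒᵖ ⥤ C ⥤ AddCommGrpCat.{w} where
  obj B :=
    { obj := fun A => AddCommGrpCat.of (∀ i : I, ExtGrp X.E (B.unop i) A)
      map := fun a => AddCommGrpCat.ofHom
        (AddMonoidHom.mk' (fun η i => push X.E a (η i)) (by intros; ext; simp))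
      map_id := by intro A; ext η i; exact push_id X.E (η i)
      map_comp := by intro A A' A'' a b; ext η i; exact push_comp X.E a b (η i) }
  map b :=
    { app := fun A => AddCommGrpCat.ofHom
        (AddMonoidHom.mk' (fun η i => pull X.E (b.unop i) (η i)) (by intros; ext; simp))
      naturality := by
        intro A A' a; ext η i; exact pull_push X.E (b.unop i) a (η i) }
  map_id := by intro B; ext A η i; exact pull_id X.E (η i)
  map_comp := by
    intro B B' B'' b b'; ext A η i; exact pull_comp X.E (b.unop i) (b'.unop i) (η i)

/-- The bifunctor `(B, A) ↦ E(∐ B, A)` on `(I → C)ᵒᵖ × C`. -/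
noncomputable def extCoprod (I : Type w) [HasCoproductsOfShape I C] :
    (I → C)ᵒᵖ ⥤ C ⥤ AddCommGrpCat.{w} :=
  (coprodFunctor C I).op ⋙ X.E

/-- The bifunctor `(B, A) ↦ E(∐ B, A^(I))` on `(I → C)ᵒᵖ × C`. -/
noncomputable def extCoprodCopower (I : Type w) [HasCoproductsOfShape I C] :
    (I → C)ᵒᵖ ⥤ C ⥤ AddCommGrpCat.{w} :=
  X.extCoprod I ⋙ (Functor.whiskeringLeft C C AddCommGrpCat.{w}).obj (copowerFunctor C I)

/-- `τ : E(∐ B, A) ⟶ ∏ i, E(B i, A)`, `ε ↦ (ε · μ i)`, with `μ i` the canonical inclusions,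
as a morphism of bifunctors. -/
noncomputable def tau (I : Type w) [HasCoproductsOfShape I C] :
    X.extCoprod I ⟶ X.prodExtLeft I where
  app B :=
    { app := fun A => AddCommGrpCat.ofHom
        (AddMonoidHom.mk' (fun (ε : ExtGrp X.E (∐ B.unop) A) (i : I) =>
          pull X.E (Limits.Sigma.ι B.unop i) ε)
          fun _ _ => funext fun _ => map_add _ _ _)
      naturality := by
        intro A A' a; ext ε; funext i
        exact pull_push X.E (Limits.Sigma.ι B.unop i) a ε }
  naturality := by
    intro B B' b; ext A ε; funext i
    have key : ∀ x : ExtGrp X.E (∐ B.unop) A,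
        pull X.E (Limits.Sigma.ι B'.unop i) (pull X.E (Limits.Sigma.map b.unop) x) =
          pull X.E (b.unop i) (pull X.E (Limits.Sigma.ι B.unop i) x) := by
      intro x
      rw [← pull_comp, ← pull_comp, Limits.Sigma.ι_map]
    exact key ε

/-- The value of a transformation `Γ` on a family of extensions. -/
noncomputable def evalGamma {I : Type w} [HasCoproductsOfShape I C]
    (Γ : X.prodExtLeft I ⟶ X.extCoprodCopower I) {B : I → C} {A : C}
    (η : ∀ i, ExtGrp X.E (B i) A) : ExtGrp X.E (∐ B) (∐ fun _ : I => A) :=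
  ((Γ.app (Opposite.op B)).app A).hom η

/-- The condition AET4 for the index set `I`: there is a natural transformation
`Γ : ∏ i, E(B i, A) ⟶ E(∐ B, A^(I))` such that coproducts and coproduct inclusions are
extriangulated via `Γ`. -/
def AET4On (I : Type w) [HasCoproductsOfShape I C] : Prop :=
  ∃ Γ : X.prodExtLeft I ⟶ X.extCoprodCopower I,
    (∀ (B : I → C) (A : C) (η : ∀ i, ExtGrp X.E (B i) A) (S : ∀ i, Seq A (B i)),
      (∀ i, X.s (η i) = ⟦S i⟧) →
        X.s (X.evalGamma Γ η) = ⟦⟨∐ fun i => (S i).mid,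
          Limits.Sigma.map fun i => (S i).f, Limits.Sigma.map fun i => (S i).g⟩⟧) ∧
    (∀ (B : I → C) (A : C) (η : ∀ i, ExtGrp X.E (B i) A) (i : I),
      pull X.E (Limits.Sigma.ι B i) (X.evalGamma Γ η) =
        push X.E (Limits.Sigma.ι (fun _ : I => A) i) (η i))

/-- The condition AET4. -/
def AET4 [HasCoproducts.{w} C] : Prop :=
  ∀ I : Type w, Nonempty I → X.AET4On I

/-- For every non-empty set `I`, the map `τ` is a natural isomorphism. -/
def TauIso [HasCoproducts.{w} C] : Prop :=
  ∀ I : Type w, Nonempty I → IsIso (X.tau I)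

/-- There is a universal `E`-extension of `V` by `D`. -/
def HasUniversalExtension [HasCoproducts.{w} C] (V D : C) : Prop :=
  ∃ (J : Type w) (_ : Nonempty J) (η : ExtGrp X.E (∐ fun _ : J => V) D),
    Function.Surjective fun f : V ⟶ ∐ (fun _ : J => V) => pull X.E f η

end Coproducts

/-! ### Products and the condition AET4* -/

section Products

/-- The condition AET4*: the opposite extriangulated category is AET4. -/
def AET4Star [HasProducts.{w} C] : Prop := X.op.AET4

/-- The functor `∏ : (I → C) ⥤ C` on the product category. -/
noncomputable def prodFunctor (C : Type u) [Category.{v} C] (I : Type w)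
    [HasProductsOfShape I C] : (I → C) ⥤ C where
  obj B := ∏ᶜ B
  map b := Limits.Pi.map b

/-- The bifunctor `(A, B) ↦ ∏ i, E(A, B i)` on `Cᵒᵖ × (I → C)`. -/
def prodExtRight (I : Type w) : Cᵒᵖ ⥤ (I → C) ⥤ AddCommGrpCat.{w} where
  obj A :=
    { obj := fun B => AddCommGrpCat.of (∀ i : I, ExtGrp X.E A.unop (B i))
      map := fun b => AddCommGrpCat.ofHom
        (AddMonoidHom.mk' (fun η i => push X.E (b i) (η i)) (by intros; ext; simp))
      map_id := by intro B; ext η i; exact push_id X.E (η i)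
      map_comp := by
        intro B B' B'' b b'; ext η i; exact push_comp X.E (b i) (b' i) (η i) }
  map a :=
    { app := fun B => AddCommGrpCat.ofHom
        (AddMonoidHom.mk' (fun η i => pull X.E a.unop (η i)) (by intros; ext; simp))
      naturality := by
        intro B B' b; ext η i; exact pull_push X.E a.unop (b i) (η i) }
  map_id := by intro A; ext B η i; exact pull_id X.E (η i)
  map_comp := by
    intro A A' A'' a a'; ext B η i; exact pull_comp X.E a.unop a'.unop (η i)

/-- The bifunctor `(A, B) ↦ E(A, ∏ B)` on `Cᵒᵖ × (I → C)`. -/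
noncomputable def extProd (I : Type w) [HasProductsOfShape I C] :
    Cᵒᵖ ⥤ (I → C) ⥤ AddCommGrpCat.{w} :=
  X.E ⋙ (Functor.whiskeringLeft (I → C) C AddCommGrpCat.{w}).obj (prodFunctor C I)

/-- `τ : E(A, ∏ B) ⟶ ∏ i, E(A, B i)`, `ε ↦ (π i · ε)`, with `π i` the canonical projections,
as a morphism of bifunctors. -/
noncomputable def tauStar (I : Type w) [HasProductsOfShape I C] :
    X.extProd I ⟶ X.prodExtRight I where
  app A :=
    { app := fun B => AddCommGrpCat.ofHom
        (AddMonoidHom.mk' (fun (ε : ExtGrp X.E A.unop (∏ᶜ B)) (i : I) =>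
          push X.E (Limits.Pi.π B i) ε)
          fun _ _ => funext fun _ => map_add _ _ _)
      naturality := by
        intro B B' b; ext ε; funext i
        have key : ∀ x : ExtGrp X.E A.unop (∏ᶜ B),
            push X.E (Limits.Pi.π B' i) (push X.E (Limits.Pi.map b) x) =
              push X.E (b i) (push X.E (Limits.Pi.π B i) x) := by
          intro x
          rw [← push_comp, ← push_comp, Limits.Pi.map_π]
        exact key ε }
  naturality := by
    intro A A' a; ext B ε; funext i
    exact (pull_push X.E a.unop (Limits.Pi.π B i) ε).symm

/-- For every non-empty set `I`, the map `τ : E(A, ∏ B) ⟶ ∏ i, E(A, B i)` is a natural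
isomorphism. -/
def TauStarIso [HasProducts.{w} C] : Prop :=
  ∀ I : Type w, Nonempty I → IsIso (X.tauStar I)

/-- There is a universal `E`-coextension of `V` by `D`. -/
def HasUniversalCoextension [HasProducts.{w} C] (V D : C) : Prop :=
  ∃ (J : Type w) (_ : Nonempty J) (η : ExtGrp X.E D (∏ᶜ fun _ : J => V)),
    Function.Surjective fun g : ∏ᶜ (fun _ : J => V) ⟶ V => push X.E g η

end Products

/-! ### Negative first extensions -/

/-- A negative first extension structure: an additive bifunctor `E⁻¹` with connecting
morphisms `E⁻¹(W, K) ⟶ Hom(W, A)` and `E⁻¹(A, W) ⟶ Hom(K, W)` for every `δ` in `E(K, A)`, natural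
in `W` and in `δ`, that extend the exact sequences of every conflation to the left. -/
structure NegativeFirstExtension where
  En : Cᵒᵖ ⥤ C ⥤ AddCommGrpCat.{w}
  additive : IsAdditiveBifunctor En
  conn : ∀ {K A : C} (_ : ExtGrp X.E K A) (W : C), ExtGrp En W K →+ (W ⟶ A)
  coconn : ∀ {K A : C} (_ : ExtGrp X.E K A) (W : C), ExtGrp En A W →+ (K ⟶ W)
  conn_natural : ∀ {K A : C} (δ : ExtGrp X.E K A) {W W' : C} (h : W' ⟶ W)
    (χ : ExtGrp En W K), conn δ W' (pull En h χ) = h ≫ conn δ W χ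
  coconn_natural : ∀ {K A : C} (δ : ExtGrp X.E K A) {W W' : C} (h : W ⟶ W')
    (χ : ExtGrp En A W), coconn δ W' (push En h χ) = coconn δ W χ ≫ h
  /-- naturality with respect to a morphism of extensions `(a, c) : δ ⟶ δ'` -/
  conn_map : ∀ {K A K' A' : C} (δ : ExtGrp X.E K A) (δ' : ExtGrp X.E K' A')
    (a : A ⟶ A') (c : K ⟶ K'), push X.E a δ = pull X.E c δ' →
    ∀ (W : C) (χ : ExtGrp En W K), conn δ W χ ≫ a = conn δ' W (push En c χ)
  coconn_map : ∀ {K A K' A' : C} (δ : ExtGrp X.E K A) (δ' : ExtGrp X.E K' A')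
    (a : A ⟶ A') (c : K ⟶ K'), push X.E a δ = pull X.E c δ' →
    ∀ (W : C) (χ : ExtGrp En A' W), c ≫ coconn δ' W χ = coconn δ W (pull En a χ)
  /-- exactness of
  `E⁻¹(W, A) ⟶ E⁻¹(W, mid) ⟶ E⁻¹(W, K) ⟶ Hom(W, A) ⟶ Hom(W, mid)` -/
  exact_mid : ∀ {K A : C} {δ : ExtGrp X.E K A} {S : Seq A K}, X.s δ = ⟦S⟧ → ∀ W : C,
    Function.Exact (push En S.f : ExtGrp En W A → ExtGrp En W S.mid) (push En S.g)
  exact_right : ∀ {K A : C} {δ : ExtGrp X.E K A} {S : Seq A K}, X.s δ = ⟦S⟧ → ∀ W : C,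
    Function.Exact (push En S.g : ExtGrp En W S.mid → ExtGrp En W K) (conn δ W)
  exact_hom : ∀ {K A : C} {δ : ExtGrp X.E K A} {S : Seq A K}, X.s δ = ⟦S⟧ → ∀ W : C,
    Function.Exact (conn δ W) (fun h : W ⟶ A => h ≫ S.f)
  /-- exactness of
  `E⁻¹(K, W) ⟶ E⁻¹(mid, W) ⟶ E⁻¹(A, W) ⟶ Hom(K, W) ⟶ Hom(mid, W)` -/
  coexact_mid : ∀ {K A : C} {δ : ExtGrp X.E K A} {S : Seq A K}, X.s δ = ⟦S⟧ → ∀ W : C,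
    Function.Exact (pull En S.g : ExtGrp En K W → ExtGrp En S.mid W) (pull En S.f)
  coexact_left : ∀ {K A : C} {δ : ExtGrp X.E K A} {S : Seq A K}, X.s δ = ⟦S⟧ → ∀ W : C,
    Function.Exact (pull En S.f : ExtGrp En S.mid W → ExtGrp En A W) (coconn δ W)
  coexact_hom : ∀ {K A : C} {δ : ExtGrp X.E K A} {S : Seq A K}, X.s δ = ⟦S⟧ → ∀ W : C,
    Function.Exact (coconn δ W) (fun h : K ⟶ W => S.g ≫ h)

/-- `C` is coproduct-compatible: it has a negative first extension for which every map
`E⁻¹(∐ Y, A) ⟶ ∏ i, E⁻¹(Y i, A)` is an epimorphism. -/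
def CoproductCompatible [HasCoproducts.{w} C] : Prop :=
  ∃ N : X.NegativeFirstExtension, ∀ (A : C) (I : Type w), Nonempty I → ∀ Y : I → C,
    Function.Surjective fun (χ : ExtGrp N.En (∐ Y) A) (i : I) =>
      pull N.En (Limits.Sigma.ι Y i) χ

/-- `C` is product-compatible: it has a negative first extension for which every map
`E⁻¹(A, ∏ Y) ⟶ ∏ i, E⁻¹(A, Y i)` is an epimorphism. -/
def ProductCompatible [HasProducts.{w} C] : Prop :=
  ∃ N : X.NegativeFirstExtension, ∀ (A : C) (I : Type w), Nonempty I → ∀ Y : I → C,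
    Function.Surjective fun (χ : ExtGrp N.En A (∏ᶜ Y)) (i : I) =>
      push N.En (Limits.Pi.π Y i) χ

end Extriangulated

end Extri

namespace Extri

namespace Extriangulated

variable {C : Type u} [Category.{v} C] [Preadditive C] [HasZeroObject C]
  [HasBinaryBiproducts C] (X : Extriangulated.{w} C)

/-! ## Exactness of conflations -/

section Exactness

variable {K A : C} {δ : ExtGrp X.E K A} {S : Seq A K}

/-! `τ` is always injective: an extension of `∐ B` that restricts to zero on every summand has a
deflation through which each inclusion lifts. These lifts glue to a section, so the extension is
zero (`ext_of_isColimit`). Hence (b) only asks that families of extensions glue.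

(a) gives (b) by pushing `Γ(η)` along the codiagonal `A^(I) ⟶ A`. (b) gives (c) by gluing the family
of all elements of `E(V, D)`. Conversely, given `η i` in `E(B i, A)`, a universal extension of `∐ B`
by `A` yields every `π i`-pullback of `η i`, and these pullbacks are assembled along the inclusions.

For (b) ⇒ (a), `Γ(η)` is the unique extension restricting to `μ i · η i`. What remains is to
identify its realization `T` with the coproduct of the given conflations
(`TauIso.isIso_comparison`). The comparison `∐ E i ⟶ T.mid` is a split mono because `∐ f i` kills
`Γ(η)`. It is an epi because compatible elements of `E⁻¹(A, W)` glue to one of `E⁻¹(A^(I), W)`.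

The dual half is the coproduct half applied to the opposite extriangulated category. -/

theorem realize_op (hS : X.s δ = ⟦S⟧) :
    X.op.s (K := Opposite.op A) (A := Opposite.op K) δ = ⟦S.op⟧ :=
  congrArg SeqClass.op hS

/-- In a conflation, a morphism that is killed by the inflation factors through the
deflation. -/
theorem desc_of_comp_eq_zero {W : C} (hS : X.s δ = ⟦S⟧) (n : S.mid ⟶ W) (hn : S.f ≫ n = 0) :
    ∃ m : K ⟶ W, S.g ≫ m = n := by
  obtain ⟨m, hm⟩ := X.op.lift_of_comp_eq_zero (X.realize_op hS) n.op
    (Quiver.Hom.unop_inj hn)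
  exact ⟨m.unop, Quiver.Hom.op_inj hm⟩

theorem inflation_comp_deflation (hS : X.s δ = ⟦S⟧) : S.f ≫ S.g = 0 := by
  obtain ⟨Z, hZ⟩ := HasZeroObject.zero (C := C)
  -- The split conflation `A ⟶ A ⊞ Z ⟶ Z` with `Z` zero maps to `S`; restricting the right-hand
  -- square to `A` gives the claim.
  obtain ⟨c, hc, -⟩ := X.et3 (X.realize_zero Z A) hS (𝟙 A) (biprod.fst ≫ S.f) (by simp)
  have h := congrArg (fun t => biprod.inl ≫ t) hc
  simpa using h.symm

/-- By (ET3)ᵒᵖ, `(a, S.g)` is a morphism of extensions from the zero class in `E(S.mid, Z)` to `δ`,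
so the pullback is a pushforward of zero. -/
theorem pull_deflation (hS : X.s δ = ⟦S⟧) : pull X.E S.g δ = 0 := by
  obtain ⟨Z, hZ⟩ := HasZeroObject.zero (C := C)
  obtain ⟨a, -, ha⟩ := X.et3_op (X.realize_zero S.mid Z) hS biprod.snd S.g rfl
  rw [← ha, map_zero]

theorem push_inflation (hS : X.s δ = ⟦S⟧) : push X.E S.f δ = 0 :=
  X.op.pull_deflation (X.realize_op hS)

/-- When the pullback vanishes, it is realized by `A ⊞ W`, and the summand `W` of that split
conflation carries the lift. -/
theorem lift_of_pull_eq_zero {W : C} (hS : X.s δ = ⟦S⟧) (c : W ⟶ K) (hc : pull X.E c δ = 0) :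
    ∃ b : W ⟶ S.mid, b ≫ S.g = c := by
  obtain ⟨b, -, hb⟩ := X.realize_map (X.realize_zero W A) hS (𝟙 A) c (by rw [hc, map_zero])
  refine ⟨biprod.inr ≫ b, ?_⟩
  rw [Category.assoc, ← hb]; simp

theorem desc_of_push_eq_zero {W : C} (hS : X.s δ = ⟦S⟧) (a : A ⟶ W) (ha : push X.E a δ = 0) :
    ∃ b : S.mid ⟶ W, S.f ≫ b = a := by
  obtain ⟨b, hb⟩ := X.op.lift_of_pull_eq_zero (X.realize_op hS) a.op ha
  exact ⟨b.unop, Quiver.Hom.op_inj hb⟩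

end Exactness

/-! ## Coproducts -/

section Coproducts

/-- An extension of a coproduct is determined by its restrictions to the summands. -/
theorem ext_of_isColimit {I : Type w} {B : I → C} {c : Cofan B} (hc : IsColimit c) {A : C}
    {ε ε' : ExtGrp X.E c.pt A} (h : ∀ i, pull X.E (c.inj i) ε = pull X.E (c.inj i) ε') :
    ε = ε' := by
  rw [← sub_eq_zero]
  obtain ⟨S, hS⟩ := Quotient.exists_rep (X.s (ε - ε'))
  -- The lifts of the inclusions glue to a section of the deflation `S.g`, and pulling back along
  -- `S.g` kills the extension.
  choose b hb using fun i => X.lift_of_pull_eq_zero hS.symm (c.inj i)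
    (by rw [map_sub, h i, sub_self])
  have hid : Cofan.IsColimit.desc hc b ≫ S.g = 𝟙 c.pt :=
    Cofan.IsColimit.hom_ext hc _ _ fun i => by
      rw [← Category.assoc, Cofan.IsColimit.fac, hb]; simp
  rw [← pull_id X.E (ε - ε'), ← hid, pull_comp, X.pull_deflation hS.symm, map_zero]

/-! ### Conditions on cofans, independent of the chosen colimit -/

/-- Every family of extensions of the summands extends to the cofan point. -/
def ExtendsFamilies {I : Type w} {B : I → C} (c : Cofan B) : Prop :=
  ∀ (A : C) (η : ∀ i, ExtGrp X.E (B i) A), ∃ ε : ExtGrp X.E c.pt A,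
    ∀ i, pull X.E (c.inj i) ε = η i

variable {X} in
-- Needed for duality: the opposite of a product cone in `C` and the chosen coproduct in `Cᵒᵖ` are
-- different cofans of the same family.
theorem ExtendsFamilies.of_isColimit {I : Type w} {B : I → C} {c c' : Cofan B}
    (h : X.ExtendsFamilies c) (hc' : IsColimit c') : X.ExtendsFamilies c' := by
  intro A η
  obtain ⟨ε, hε⟩ := h A η
  refine ⟨pull X.E (Cofan.IsColimit.desc hc' c.inj) ε, fun i => ?_⟩
  rw [← pull_comp, Cofan.IsColimit.fac, hε]

/-- Every extension of `V` by `D` is a pullback of a single extension of the cofan point. -/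
def IsUniversalFor {J : Type w} {V : C} (c : Cofan fun _ : J => V) (D : C) : Prop :=
  ∃ η : ExtGrp X.E c.pt D, Function.Surjective fun f : V ⟶ c.pt => pull X.E f η

variable {X} in
theorem IsUniversalFor.of_isColimit {J : Type w} {V D : C} {c c' : Cofan fun _ : J => V}
    (h : X.IsUniversalFor c D) (hc : IsColimit c) (hc' : IsColimit c') :
    X.IsUniversalFor c' D := by
  obtain ⟨η, hη⟩ := h
  refine ⟨pull X.E (Cofan.IsColimit.desc hc' c.inj) η, fun δ => ?_⟩
  obtain ⟨f, hf⟩ := hη δ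
  refine ⟨f ≫ Cofan.IsColimit.desc hc c'.inj, ?_⟩
  have hid : Cofan.IsColimit.desc hc c'.inj ≫ Cofan.IsColimit.desc hc' c.inj = 𝟙 c.pt :=
    Cofan.IsColimit.hom_ext hc _ _ fun i => by
      rw [← Category.assoc, Cofan.IsColimit.fac, Cofan.IsColimit.fac, Category.comp_id]
  change pull X.E _ (pull X.E _ η) = δ
  rw [← pull_comp, Category.assoc, hid, Category.comp_id]
  exact hf

/-! ### The map `τ` and universal extensions -/

variable [HasCoproducts.{w} C]

/-- Injectivity of `τ` is automatic by `ext_of_isColimit`, so only surjectivity is a condition. -/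
theorem isIso_tau_iff {I : Type w} :
    IsIso (X.tau I) ↔ ∀ B : I → C, X.ExtendsFamilies (colimit.cocone (Discrete.functor B)) := by
  have key : ∀ (B : (I → C)ᵒᵖ) (A : C), IsIso (((X.tau I).app B).app A) ↔
      Function.Bijective fun (ε : ExtGrp X.E (∐ B.unop) A) (i : I) =>
        pull X.E (Limits.Sigma.ι B.unop i) ε := fun B A =>
    ConcreteCategory.isIso_iff_bijective (((X.tau I).app B).app A)
  simp only [NatTrans.isIso_iff_isIso_app, key]
  constructor
  · intro h B A η
    obtain ⟨ε, hε⟩ := (h (Opposite.op B) A).2 η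
    exact ⟨ε, congrFun hε⟩
  · intro h B A
    refine ⟨fun ε ε' hε => X.ext_of_isColimit (coproductIsCoproduct B.unop) (congrFun hε),
      fun η => ?_⟩
    obtain ⟨ε, hε⟩ := h B.unop A η
    exact ⟨ε, funext hε⟩

theorem tauIso_iff : X.TauIso ↔ ∀ (I : Type w) [Nonempty I] (B : I → C) (c : Cofan B),
    IsColimit c → X.ExtendsFamilies c := by
  simp only [TauIso, isIso_tau_iff]
  exact ⟨fun h I hI B c hc => (h I hI B).of_isColimit hc,
    fun h I hI B => h I B _ (coproductIsCoproduct B)⟩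

variable {X}

theorem TauIso.exists_pull_eq (h : X.TauIso) {I : Type w} [Nonempty I] {B : I → C} {A : C}
    (η : ∀ i, ExtGrp X.E (B i) A) :
    ∃ ε : ExtGrp X.E (∐ B) A, ∀ i, pull X.E (Limits.Sigma.ι B i) ε = η i :=
  X.isIso_tau_iff.1 (h I inferInstance) B A η

variable (X) in
theorem coprod_ext {I : Type w} {B : I → C} {A : C} {ε ε' : ExtGrp X.E (∐ B) A}
    (h : ∀ i, pull X.E (Limits.Sigma.ι B i) ε = pull X.E (Limits.Sigma.ι B i) ε') : ε = ε' :=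
  X.ext_of_isColimit (coproductIsCoproduct B) h

theorem AET4.tauIso (h : X.AET4) : X.TauIso := by
  intro I hI
  obtain ⟨Γ, -, hΓ⟩ := h I hI
  rw [isIso_tau_iff]
  intro B A η
  -- The codiagonal `A^(I) ⟶ A` cancels the inclusion `μ i` in condition (2) of AET4.
  refine ⟨push X.E (Limits.Sigma.desc fun _ => 𝟙 A) (X.evalGamma Γ η), fun i => ?_⟩
  change pull X.E (Limits.Sigma.ι B i) _ = _
  rw [pull_push, hΓ, ← push_comp, Limits.Sigma.ι_desc, push_id]

theorem TauIso.hasUniversalExtension (h : X.TauIso) (V D : C) :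
    X.HasUniversalExtension V D := by
  have : Nonempty (ExtGrp X.E V D) := ⟨0⟩
  -- The copower is indexed by `E(V, D)` itself, so the inclusion at `δ` pulls the glued extension
  -- back to `δ`.
  obtain ⟨η, hη⟩ := h.exists_pull_eq (fun δ : ExtGrp X.E V D => δ)
  exact ⟨ExtGrp X.E V D, this, η, fun δ => ⟨_, hη δ⟩⟩

theorem tauIso_of_hasUniversalExtension (h : ∀ V D : C, X.HasUniversalExtension V D) :
    X.TauIso := by
  classical
  intro I hI
  rw [isIso_tau_iff]
  intro B A η
  obtain ⟨J, -, ω, hω⟩ := h (∐ B) A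
  -- Universality concerns a single object, so each `η i` is first moved to `∐ B` along the
  -- projection; restriction along the inclusion at `i` recovers it.
  choose f hf using fun i => hω (pull X.E (Sigma.π B i) (η i))
  refine ⟨pull X.E (Limits.Sigma.desc fun i => Limits.Sigma.ι B i ≫ f i) ω, fun i => ?_⟩
  change pull X.E (Limits.Sigma.ι B i) _ = _
  have hi : pull X.E (f i) ω = _ := hf i
  rw [← pull_comp, Limits.Sigma.ι_desc, pull_comp, hi, ← pull_comp, Sigma.ι_π_eq_id, pull_id]

theorem tauIso_iff_hasUniversalExtension :
    X.TauIso ↔ ∀ V D : C, X.HasUniversalExtension V D :=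
  ⟨TauIso.hasUniversalExtension, tauIso_of_hasUniversalExtension⟩

/-! ### The transformation `Γ` -/

/-- The extension of `∐ B` by `A^(I)` that restricts to `μ i · η i` on `B i`. -/
noncomputable def TauIso.sum (h : X.TauIso) {I : Type w} [Nonempty I] {B : I → C} {A : C}
    (η : ∀ i, ExtGrp X.E (B i) A) : ExtGrp X.E (∐ B) (∐ fun _ : I => A) :=
  (h.exists_pull_eq fun i => push X.E (Limits.Sigma.ι (fun _ : I => A) i) (η i)).choose

theorem TauIso.pull_sum (h : X.TauIso) {I : Type w} [Nonempty I] {B : I → C} {A : C}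
    (η : ∀ i, ExtGrp X.E (B i) A) (i : I) :
    pull X.E (Limits.Sigma.ι B i) (h.sum η) =
      push X.E (Limits.Sigma.ι (fun _ : I => A) i) (η i) :=
  (h.exists_pull_eq fun i => push X.E (Limits.Sigma.ι (fun _ : I => A) i) (η i)).choose_spec i

theorem TauIso.sum_add (h : X.TauIso) {I : Type w} [Nonempty I] {B : I → C} {A : C}
    (η η' : ∀ i, ExtGrp X.E (B i) A) : h.sum (η + η') = h.sum η + h.sum η' :=
  X.coprod_ext fun i => by simp only [map_add, h.pull_sum, Pi.add_apply]

/-- The transformation `η ↦ τ⁻¹((μ i · η i)_i)`. -/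
noncomputable def TauIso.gamma (h : X.TauIso) (I : Type w) [Nonempty I] :
    X.prodExtLeft I ⟶ X.extCoprodCopower I where
  app B :=
    { app := fun A => AddCommGrpCat.ofHom
        (AddMonoidHom.mk' (fun η : ∀ i, ExtGrp X.E (B.unop i) A => h.sum η) h.sum_add)
      naturality := by
        intro A A' a; ext η
        have key : ∀ η : ∀ i, ExtGrp X.E (B.unop i) A,
            h.sum (fun i => push X.E a (η i)) =
              push X.E (Limits.Sigma.map fun _ => a) (h.sum η) := fun η =>
          X.coprod_ext fun i => by
            rw [pull_push, h.pull_sum, h.pull_sum, ← push_comp, ← push_comp, Limits.Sigma.ι_map]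
        exact key η }
  naturality := by
    intro B B' b; ext A η
    have key : ∀ η : ∀ i, ExtGrp X.E (B.unop i) A,
        h.sum (fun i => pull X.E (b.unop i) (η i)) =
          pull X.E (Limits.Sigma.map b.unop) (h.sum η) := fun η =>
      X.coprod_ext fun i => by
        rw [h.pull_sum, ← pull_comp, Limits.Sigma.ι_map, pull_comp, h.pull_sum, pull_push]
    exact key η

/-! ### Coproducts of conflations -/

/-- The comparison morphism `∐ E i ⟶ E` from the coproduct of the middle terms of conflations
to the middle term of a realization of the sum extension is an isomorphism. -/
theorem TauIso.isIso_comparison (h : X.TauIso) (N : X.NegativeFirstExtension)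
    {I : Type w} [Nonempty I] {B : I → C} {A : C}
    (hN : ∀ W : C, Function.Surjective fun (χ : ExtGrp N.En (∐ fun _ : I => A) W) (i : I) =>
      pull N.En (Limits.Sigma.ι (fun _ : I => A) i) χ)
    (η : ∀ i, ExtGrp X.E (B i) A) {S : ∀ i, Seq A (B i)} (hS : ∀ i, X.s (η i) = ⟦S i⟧)
    {T : Seq (∐ fun _ : I => A) (∐ B)} (hT : X.s (h.sum η) = ⟦T⟧)
    (e : ∀ i, (S i).mid ⟶ T.mid)
    (hef : ∀ i, (S i).f ≫ e i = Limits.Sigma.ι (fun _ : I => A) i ≫ T.f)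
    (heg : ∀ i, (S i).g ≫ Limits.Sigma.ι B i = e i ≫ T.g) :
    IsIso (Limits.Sigma.desc e) := by
  have hepi : Epi (Limits.Sigma.desc e) := by
    rw [Preadditive.epi_iff_cancel_zero]
    intro W t ht
    have het : ∀ i, e i ≫ t = 0 := fun i => by
      rw [← Limits.Sigma.ι_desc e i, Category.assoc, ht, comp_zero]
    obtain ⟨k, hk⟩ := X.desc_of_comp_eq_zero hT t (Limits.Sigma.hom_ext _ _ fun i => by
      rw [← Category.assoc, ← hef, Category.assoc, het, comp_zero, comp_zero])
    -- `t` factors as `T.g ≫ k`, and each restriction of `k` to `B i` dies on `(S i).mid`, so it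
    -- comes from `E⁻¹(A, W)`.
    choose χ hχ using fun i => (N.coexact_hom (hS i) W (Limits.Sigma.ι B i ≫ k)).1 (by
      beta_reduce
      rw [← Category.assoc, heg, Category.assoc, hk, het])
    obtain ⟨ξ, hξ⟩ := hN W χ
    -- Naturality of `coconn` along `η i ⟶ h.sum η` shows that both sides agree on each `B i`. Then
    -- `k` lies in the image of the connecting map, so `T.g ≫ k = 0`.
    have hkξ : k = N.coconn (h.sum η) W ξ := Limits.Sigma.hom_ext _ _ fun i => by
      rw [N.coconn_map (η i) (h.sum η) _ _ (h.pull_sum η i).symm, ← hχ]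
      exact congrArg _ (congrFun hξ i).symm
    rw [← hk, hkξ]
    exact (N.coexact_hom hT W _).2 ⟨ξ, rfl⟩
  -- `∐ f i` kills `h.sum η`, since it does so after restriction to each `B i`; hence it extends
  -- over `T.mid`.
  obtain ⟨t, ht⟩ := X.desc_of_push_eq_zero hT
    (Limits.Sigma.map fun i => (S i).f) (X.coprod_ext fun i => by
      rw [pull_push, h.pull_sum, ← push_comp, Limits.Sigma.ι_map, push_comp,
        X.push_inflation (hS i), map_zero, map_zero])
  -- `t` is a retraction up to an error that vanishes on the inflations, hence factors through the
  -- deflations; adding `T.g ≫ desc l` corrects it.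
  choose l hl using fun i => X.desc_of_comp_eq_zero (hS i)
    (Limits.Sigma.ι (fun i => (S i).mid) i - e i ≫ t) (by
      rw [Preadditive.comp_sub, ← Category.assoc, hef, Category.assoc, ht, Limits.Sigma.ι_map,
        sub_self])
  have : IsSplitMono (Limits.Sigma.desc e) := ⟨⟨⟨t + T.g ≫ Limits.Sigma.desc l,
    Limits.Sigma.hom_ext _ _ fun i => by
      rw [← Category.assoc, Limits.Sigma.ι_desc, Preadditive.comp_add, ← Category.assoc (e i),
        ← heg, Category.assoc, Limits.Sigma.ι_desc, hl, Category.comp_id]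
      abel⟩⟩⟩
  exact isIso_of_epi_of_isSplitMono _

theorem TauIso.aet4 (h : X.TauIso) (hC : X.CoproductCompatible) : X.AET4 := by
  obtain ⟨N, hN⟩ := hC
  intro I hI
  refine ⟨h.gamma I, fun B A η S hS => ?_, fun B A η i => h.pull_sum η i⟩
  obtain ⟨T, hT⟩ := Quotient.exists_rep (X.s (h.sum η))
  -- The defining property of `h.sum η` says that the inclusions form a morphism of extensions from
  -- `η i`, which is then realized on middle terms.
  choose e hef heg using fun i => X.realize_map (hS i) hT.symm _ _ (h.pull_sum η i).symm
  have := h.isIso_comparison N (fun W => hN W I hI _) η hS hT.symm e hef heg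
  refine hT.symm.trans (Quotient.sound (Setoid.symm ⟨asIso (Limits.Sigma.desc e), ?_, ?_⟩))
  · exact Limits.Sigma.hom_ext _ _ fun i => by simp [hef]
  · exact Limits.Sigma.hom_ext _ _ fun i => by simp [heg]

theorem tfae_of_coproductCompatible (hC : X.CoproductCompatible) :
    [X.AET4, X.TauIso, ∀ V D : C, X.HasUniversalExtension V D].TFAE := by
  tfae_have 1 → 2 := AET4.tauIso
  tfae_have 2 → 1 := fun h => h.aet4 hC
  tfae_have 2 ↔ 3 := tauIso_iff_hasUniversalExtension
  tfae_finish

end Coproducts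

/-! ## Products -/

section Products

/-- The opposite of a negative first extension. -/
def NegativeFirstExtension.op (N : X.NegativeFirstExtension) :
    X.op.NegativeFirstExtension where
  En := opBifunctor N.En
  additive :=
    { push_add := fun a b δ => N.additive.pull_add a.unop b.unop δ
      pull_add := fun c d δ => N.additive.push_add c.unop d.unop δ }
  conn := fun {K A} δ W => AddMonoidHom.mk'
    (fun χ => (N.coconn (K := A.unop) (A := K.unop) δ W.unop χ).op)
    (fun χ χ' => congrArg Quiver.Hom.op (map_add (N.coconn (K := A.unop) δ W.unop) χ χ'))
  coconn := fun {K A} δ W => AddMonoidHom.mk'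
    (fun χ => (N.conn (K := A.unop) (A := K.unop) δ W.unop χ).op)
    (fun χ χ' => congrArg Quiver.Hom.op (map_add (N.conn (A := K.unop) δ W.unop) χ χ'))
  conn_natural := fun {K A} δ {_ _} h χ =>
    congrArg Quiver.Hom.op (N.coconn_natural (K := A.unop) (A := K.unop) δ h.unop χ)
  coconn_natural := fun {K A} δ {_ _} h χ =>
    congrArg Quiver.Hom.op (N.conn_natural (K := A.unop) (A := K.unop) δ h.unop χ)
  conn_map := fun {K A K' A'} δ δ' a c h W χ =>
    congrArg Quiver.Hom.op (N.coconn_map (K := A'.unop) (A := K'.unop) (K' := A.unop)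
      (A' := K.unop) δ' δ c.unop a.unop h.symm W.unop χ)
  coconn_map := fun {K A K' A'} δ δ' a c h W χ =>
    congrArg Quiver.Hom.op (N.conn_map (K := A'.unop) (A := K'.unop) (K' := A.unop)
      (A' := K.unop) δ' δ c.unop a.unop h.symm W.unop χ)
  exact_mid := fun hS W => N.coexact_mid (seqClass_op_eq hS) W.unop
  -- The connecting maps of the opposite are those of `N` wrapped in `op`, so vanishing is
  -- transferred by injectivity of `op`.
  exact_right := fun hS W χ =>
    Quiver.Hom.op_inj.eq_iff.trans (N.coexact_left (seqClass_op_eq hS) W.unop χ)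
  exact_hom := fun hS W n =>
    (Quiver.Hom.unop_inj.eq_iff.symm.trans
      (N.coexact_hom (seqClass_op_eq hS) W.unop n.unop)).trans
        (exists_congr fun _ => Quiver.Hom.op_inj.eq_iff.symm)
  coexact_mid := fun hS W => N.exact_mid (seqClass_op_eq hS) W.unop
  coexact_left := fun hS W χ =>
    Quiver.Hom.op_inj.eq_iff.trans (N.exact_right (seqClass_op_eq hS) W.unop χ)
  coexact_hom := fun hS W n =>
    (Quiver.Hom.unop_inj.eq_iff.symm.trans
      (N.exact_hom (seqClass_op_eq hS) W.unop n.unop)).trans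
        (exists_congr fun _ => Quiver.Hom.op_inj.eq_iff.symm)

/-! ### The dual conditions as conditions on the opposite category -/

variable [HasProducts.{w} C]

theorem isIso_tauStar_iff {I : Type w} : IsIso (X.tauStar I) ↔ ∀ B : I → C,
    X.op.ExtendsFamilies (Fan.op (limit.cone (Discrete.functor B))) := by
  have key : ∀ (A : Cᵒᵖ) (B : I → C), IsIso (((X.tauStar I).app A).app B) ↔
      Function.Bijective fun (ε : ExtGrp X.E A.unop (∏ᶜ B)) (i : I) =>
        push X.E (Limits.Pi.π B i) ε := fun A B =>
    ConcreteCategory.isIso_iff_bijective (((X.tauStar I).app A).app B)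
  simp only [NatTrans.isIso_iff_isIso_app, key]
  constructor
  · intro h B A η
    obtain ⟨ε, hε⟩ := (h A B).2 η
    exact ⟨ε, congrFun hε⟩
  · intro h A B
    refine ⟨fun ε ε' hε => X.op.ext_of_isColimit (Fan.IsLimit.op (productIsProduct B))
      (congrFun hε), fun η => ?_⟩
    obtain ⟨ε, hε⟩ := h B A η
    exact ⟨ε, funext hε⟩

theorem tauStarIso_iff_op : X.TauStarIso ↔ X.op.TauIso := by
  simp only [TauStarIso, isIso_tauStar_iff, tauIso_iff]
  exact ⟨fun h I hI B c hc => (h I hI fun i => (B i).unop).of_isColimit hc,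
    fun h I hI B => h I _ _ (Fan.IsLimit.op (productIsProduct B))⟩

theorem hasUniversalCoextension_iff_op (V D : C) :
    X.HasUniversalCoextension V D ↔
      X.op.HasUniversalExtension (Opposite.op V) (Opposite.op D) := by
  have key : ∀ (J : Type w) (η : ExtGrp X.E D (∏ᶜ fun _ : J => V)),
      (Function.Surjective fun g : ∏ᶜ (fun _ : J => V) ⟶ V => push X.E g η) ↔
        Function.Surjective fun f : Opposite.op V ⟶ Opposite.op (∏ᶜ fun _ : J => V) =>
          push X.E f.unop η := fun J η =>
    ⟨fun h δ => let ⟨g, hg⟩ := h δ; ⟨g.op, hg⟩, fun h δ => let ⟨f, hf⟩ := h δ; ⟨f.unop, hf⟩⟩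
  constructor
  · rintro ⟨J, hJ, η, hη⟩
    -- `η` is already universal on the opposite of the product cone; it is then transported to the
    -- chosen coproduct in `Cᵒᵖ`.
    have hu : X.op.IsUniversalFor (Fan.op (limit.cone (Discrete.functor fun _ : J => V)))
        (Opposite.op D) := ⟨η, (key J η).1 hη⟩
    obtain ⟨ω, hω⟩ := hu.of_isColimit (Fan.IsLimit.op (productIsProduct _))
      (coproductIsCoproduct fun _ : J => Opposite.op V)
    exact ⟨J, hJ, ω, hω⟩
  · rintro ⟨J, hJ, η, hη⟩
    have hu : X.op.IsUniversalFor
        (colimit.cocone (Discrete.functor fun _ : J => Opposite.op V))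
        (Opposite.op D) := ⟨η, hη⟩
    obtain ⟨ω, hω⟩ := hu.of_isColimit (coproductIsCoproduct _)
      (Fan.IsLimit.op (productIsProduct fun _ : J => V))
    exact ⟨J, hJ, ω, (key J ω).2 hω⟩

theorem forall_hasUniversalCoextension_iff_op :
    (∀ V D : C, X.HasUniversalCoextension V D) ↔
      ∀ V D : Cᵒᵖ, X.op.HasUniversalExtension V D := by
  simp only [hasUniversalCoextension_iff_op]
  exact ⟨fun h V D => h V.unop D.unop, fun h V D => h _ _⟩

theorem ProductCompatible.op (h : X.ProductCompatible) : X.op.CoproductCompatible := by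
  obtain ⟨N, hN⟩ := h
  refine ⟨N.op, fun A I hI Y χ => ?_⟩
  obtain ⟨ξ, hξ⟩ : ∃ ξ : ExtGrp N.op.En (Opposite.op (∏ᶜ fun i => (Y i).unop)) A,
      ∀ i, pull N.op.En (Pi.π (fun i => (Y i).unop) i).op ξ = χ i :=
    (hN A.unop I hI (fun i => (Y i).unop) χ).imp fun _ => congrFun
  -- The product in `C` gives `ξ` on the opposite of the product; it is moved to the chosen
  -- coproduct along the comparison morphism.
  refine ⟨pull N.op.En (Limits.Sigma.desc fun i => (Pi.π (fun i => (Y i).unop) i).op) ξ,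
    funext fun i => ?_⟩
  beta_reduce
  rw [← pull_comp, Limits.Sigma.ι_desc, hξ]

end Products

end Extriangulated

end Extri

theorem theoremA {C : Type u} [Category.{v} C] [Preadditive C] [HasZeroObject C]
    [HasBinaryBiproducts C] (X : Extri.Extriangulated.{w} C) :
    (∀ [HasCoproducts.{w} C],
      (X.AET4 → X.TauIso) ∧
      (X.TauIso ↔ ∀ V D : C, X.HasUniversalExtension V D) ∧
      (X.CoproductCompatible →
        [X.AET4, X.TauIso, ∀ V D : C, X.HasUniversalExtension V D].TFAE)) ∧
    (∀ [HasProducts.{w} C],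
      (X.AET4Star → X.TauStarIso) ∧
      (X.TauStarIso ↔ ∀ V D : C, X.HasUniversalCoextension V D) ∧
      (X.ProductCompatible →
        [X.AET4Star, X.TauStarIso, ∀ V D : C, X.HasUniversalCoextension V D].TFAE)) := by
  refine ⟨?_, ?_⟩
  · intro _
    exact ⟨Extri.Extriangulated.AET4.tauIso,
      Extri.Extriangulated.tauIso_iff_hasUniversalExtension,
      Extri.Extriangulated.tfae_of_coproductCompatible⟩
  · intro _
    -- `AET4Star` is AET4 for `X.op` by definition; once the other two conditions are rewritten,
    -- only the coproduct statements for `X.op` remain.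
    rw [Extri.Extriangulated.tauStarIso_iff_op,
      Extri.Extriangulated.forall_hasUniversalCoextension_iff_op]
    exact ⟨Extri.Extriangulated.AET4.tauIso,
      Extri.Extriangulated.tauIso_iff_hasUniversalExtension,
      fun h => Extri.Extriangulated.tfae_of_coproductCompatible h.op⟩
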